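/- Let $f:\mathbb{R}^n\to\mathbb{R}$ be three times continuously differentiable, bounded below by $f_{\rm low}$, with $\|\nabla^3 f(x)-\nabla^3 f(y)\|\le L\|x-y\|$ for all $x,y$ (where $L\ge 3$) and $\|\nabla^3 f(x)\|\le\kappa_3$ for all $x$. Here $\|\cdot\|$ is the Euclidean norm of vectors, and $\|T\|=\max_{\|s_1\|=\dots=\|s_p\|=1}|T[s_1,\dots,s_p]|$ for tensors; $\lambda_{\min}$ denotes the leftmost eigenvalue of a symmetric matrix. Consider Algorithm ARp-approx with $p=3$, starting point $x_0\in\mathbb{R}^n$ and parameters $\sigma_0>0$, $\theta_1,\theta_2>1$, an integer $m\ge1$, $\kappa_A,\kappa_B\ge0$ and $\kappa_C\ge1$. It generates iterates $x_k$, steps $s_k$, numbers $\sigma_k$ and $3$-tensors $T_k$ ($k\ge0$) as follows. Put $\|s_{j}\|:=1$ for $j<0$ and $\widetilde T_k:=\int_0^1\nabla^3 f(x_k+ts_k)\,dt$. At iteration $k$: 1. $T_k$ is any tensor such that, if $k\bmod m=0$, then $\|T_k-\nabla^3 f(x_k)\|\le\min\bigl(\kappa_A\sum_{i=1}^m\|s_{k-i}\|,\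 \kappa_B\bigr)$, and otherwise $\|T_k-\widetilde T_{k-1}\|\le\kappa_C\,\|T_{k-1}-\widetilde T_{k-1}\|$. 2. With $\overline T_f(x_k,s)=f(x_k)+\nabla f(x_k)[s]+\tfrac12\nabla^2f(x_k)[s]^2+\tfrac16T_k[s]^3$ and $m_k(s)=\overline T_f(x_k,s)+\tfrac{\sigma_k}{24}\|s\|^4$, the step $s_k$ is any vector such that $$m_k(s_k)-m_k(0)\le0,\qquad \|\nabla_s^1\overline T_f(x_k,s_k)\|\le\frac{\theta_1\sigma_k\|s_k\|^3}{3!},\qquad \max[0,-\lambda_{\min}(\nabla_s^2\overline T_f(x_k,s_k))]\le\frac{\theta_2\sigma_k\|s_k\|^2}{2!}.$$ 3. $x_{k+1}=x_k+s_k$ and $\sigma_{k+1}=\sigma_k+\sigma_k\|s_k\|^4$. Then there are constants $C_1,C_2$, depending only on $m,\theta_1,\theta_2,\sigma_0,\kappa_A,\kappa_B,\kappa_C,L,\kappa_3$ and on upper bounds for $f(x_0)-f_{\rm low}$, $\|\nabla f(x_0)\|$ and $\max[0,-\lambda_{\min}(\nabla^2f(x_0))]$, such that for every sequence generated by the algorithm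 and every $k\ge0$, $$\min_{1\le j\le k+1}\|\nabla f(x_j)\|\le\frac{C_1}{(k+1)^{3/4}},\qquad \min_{1\le j\le k+1}\max[0,-\lambda_{\min}(\nabla^2 f(x_j))]\le\frac{C_2}{(k+1)^{1/2}}.$$ -/

import Mathlib

open scoped Nat

namespace ARpApprox

/-- The space `ℝⁿ` with the Euclidean norm. -/
abbrev Vec (n : ℕ) : Type := EuclideanSpace ℝ (Fin n)

/-- The space of `p`-tensors on `ℝⁿ` (real `p`-linear maps), with the norm
`‖T‖ = max_{‖s₁‖ = … = ‖s_p‖ = 1} |T[s₁, …, s_p]|`. -/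
abbrev Tensor (n p : ℕ) : Type := ContinuousMultilinearMap ℝ (fun _ : Fin p => Vec n) ℝ

variable {n p : ℕ}

/-- The Hessian matrix of `f` at `x`, with entries `∇²f(x)[eᵢ, eⱼ]`. -/
noncomputable def hessianMatrix (f : Vec n → ℝ) (x : Vec n) : Matrix (Fin n) (Fin n) ℝ :=
  Matrix.of fun i j =>
    iteratedFDeriv ℝ 2 f x ![EuclideanSpace.single i (1 : ℝ), EuclideanSpace.single j (1 : ℝ)]

/-- The leftmost (real) eigenvalue of a matrix. -/
noncomputable def lambdaMin (A : Matrix (Fin n) (Fin n) ℝ) : ℝ :=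
  sInf {μ : ℝ | Module.End.HasEigenvalue (Matrix.toLin' A) μ}

/-- The magnitude of the negative curvature, `max[0, -λ_min(∇²f(x))]`. -/
noncomputable def negCurvature (f : Vec n → ℝ) (x : Vec n) : ℝ :=
  max 0 (-lambdaMin (hessianMatrix f x))

/-- The Taylor expansion of order `p` of `f` at `x` in which the `p`-th derivative
is replaced by the tensor `T`, as a function of the step `s`. -/
noncomputable def approxTaylor (f : Vec n → ℝ) (x : Vec n) (T : Tensor n p) (s : Vec n) : ℝ :=
  f x + ∑ i ∈ Finset.Icc 1 (p - 1), (1 / (i ! : ℝ)) * iteratedFDeriv ℝ i f x (fun _ => s)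
    + T (fun _ => s) / (p ! : ℝ)

/-- The regularized model. -/
noncomputable def model (f : Vec n → ℝ) (x : Vec n) (T : Tensor n p) (σ : ℝ) (s : Vec n) : ℝ :=
  approxTaylor f x T s + σ / ((p + 1)! : ℝ) * ‖s‖ ^ (p + 1)

/-- The average `∫₀¹ ∇ᵖf(x + t s) dt` of the `p`-th derivative on the segment `[x, x + s]`. -/
noncomputable def averagedTensor (p : ℕ) (f : Vec n → ℝ) (x s : Vec n) : Tensor n p :=
  ∫ t in (0 : ℝ)..1, iteratedFDeriv ℝ p f (x + t • s)

/-- The step length `‖s_j‖` for an integer index, equal to `1` by convention when `j < 0`. -/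
noncomputable def stepLength (s : ℕ → Vec n) (j : ℤ) : ℝ :=
  if j < 0 then 1 else ‖s j.toNat‖

/-- `f` is `p` times continuously differentiable, `p ≥ 2`. -/
def SmoothObjective (p : ℕ) (f : Vec n → ℝ) : Prop :=
  2 ≤ p ∧ ContDiff ℝ p f

/-- `f` is bounded below by `fLow`. -/
def BoundedBelowBy (f : Vec n → ℝ) (fLow : ℝ) : Prop :=
  ∀ x, fLow ≤ f x

/-- The `p`-th derivative of `f` is globally Lipschitz continuous with constant `L ≥ 3`. -/
def LipschitzTensor (p : ℕ) (f : Vec n → ℝ) (L : ℝ) : Prop :=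
  3 ≤ L ∧ ∀ x y, ‖iteratedFDeriv ℝ p f x - iteratedFDeriv ℝ p f y‖ ≤ L * ‖x - y‖

/-- The derivatives of orders `3, …, p - 1` are bounded below along unit directions. -/
def IntermediateBoundedBelow (p : ℕ) (f : Vec n → ℝ) : Prop :=
  ∃ κHigh : ℝ, 0 ≤ κHigh ∧ ∀ i ∈ Finset.Icc 3 (p - 1), ∀ x d : Vec n, ‖d‖ ≤ 1 →
    -κHigh ≤ iteratedFDeriv ℝ i f x (fun _ => d)

/-- If `p ≥ 3`, the `p`-th derivative of `f` is bounded by `κ`. -/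
def BoundedTensor (p : ℕ) (f : Vec n → ℝ) (κ : ℝ) : Prop :=
  3 ≤ p → ∀ x, ‖iteratedFDeriv ℝ p f x‖ ≤ κ

/-- The parameters of the algorithm. -/
structure Params where
  /-- memory length -/
  m : ℕ
  θ₁ : ℝ
  θ₂ : ℝ
  /-- initial regularization parameter -/
  σ₀ : ℝ
  κA : ℝ
  κB : ℝ
  κC : ℝ
  one_le_m : 1 ≤ m
  one_lt_θ₁ : 1 < θ₁
  one_lt_θ₂ : 1 < θ₂
  σ₀_pos : 0 < σ₀
  κA_nonneg : 0 ≤ κA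
  κB_nonneg : 0 ≤ κB
  one_le_κC : 1 ≤ κC

/-- `x`, `s`, `σ`, `T` are the iterates, steps, regularization parameters and approximate
`p`-th order tensors of a run of the adaptive `p`-th order regularization method with
parameters `P`, applied to `f` from the starting point `x₀`. -/
structure IsRun (P : Params) (f : Vec n → ℝ) (x₀ : Vec n)
    (x s : ℕ → Vec n) (σ : ℕ → ℝ) (T : ℕ → Tensor n p) : Prop where
  x_zero : x 0 = x₀
  σ_zero : σ 0 = P.σ₀
  /-- the condition on the approximate tensor when `k` is a multiple of `m` -/
  tensor_restart : ∀ k : ℕ, k % P.m = 0 →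
    ‖T k - iteratedFDeriv ℝ p f (x k)‖ ≤
      min (P.κA * ∑ i ∈ Finset.Icc 1 P.m, stepLength s ((k : ℤ) - (i : ℤ))) P.κB
  /-- the condition on the approximate tensor at the other indices `k + 1` -/
  tensor_update : ∀ k : ℕ, (k + 1) % P.m ≠ 0 →
    ‖T (k + 1) - averagedTensor p f (x k) (s k)‖ ≤
      P.κC * ‖T k - averagedTensor p f (x k) (s k)‖
  step_decrease : ∀ k,
    model f (x k) (T k) (σ k) (s k) - model f (x k) (T k) (σ k) 0 ≤ 0
  step_gradient : ∀ k,
    ‖gradient (approxTaylor f (x k) (T k)) (s k)‖ ≤ P.θ₁ * σ k * ‖s k‖ ^ p / (p ! : ℝ)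
  step_curvature : ∀ k,
    negCurvature (approxTaylor f (x k) (T k)) (s k) ≤
      P.θ₂ * σ k * ‖s k‖ ^ (p - 1) / ((p - 1)! : ℝ)
  x_succ : ∀ k, x (k + 1) = x k + s k
  σ_succ : ∀ k, σ (k + 1) = σ k + σ k * ‖s k‖ ^ (p + 1)

/-- `min_{1 ≤ j ≤ k + 1} a_j`. -/
noncomputable def minUpTo (a : ℕ → ℝ) (k : ℕ) : ℝ :=
  (Finset.Icc 1 (k + 1)).inf' (Finset.nonempty_Icc.mpr (Nat.le_add_left 1 k)) a

end ARpApprox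

/-! Write `ℓ k` for the length of the step `s k` and `w k` for the sum of the last `2m + 1` lengths,
`ℓ k` included. Between restarts each update of the approximate tensor multiplies its error by at
most `κC` after adding a multiple of the current step length, so the error is at most a constant
times the preceding `2m` lengths (`IsRun.norm_tensor_sub_le`). By Taylor's inequality the model then
errs at `s k` by at most `E * w k ^ 4` in value, `E * w k ^ 3` in gradient and `E * w k ^ 2` in
Hessian. `IsRun.scalarRun` records what this gives for real sequences; the rest is scalar.

If `σ` is bounded, the gradient at `x (k + 1)` is `O(w k ^ 3)` and the negative curvature `O(w k ^
2)`. The sum of `σ j * ℓ j ^ 4` telescopes to `σ k - σ₀`, so the sum of `w j ^ 4` is bounded as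
well, and one of the first `k + 1` terms is `O(1 / (k + 1))`. This yields both rates.

To bound `σ` (`ScalarRun.exists_σ_bound`), sum the objective decrease: `σ k ≤ a + b * ∑ ℓ j ^ 4`.
For a threshold `S > 2b`, the steps with `σ j ≥ S` contribute at most `(σ k - σ₀) / S` to the sum,
which is absorbed on the left. Among the steps with `σ j < S`, telescoping controls all but the
last. That one is bounded because the model does not increase: its quartic term is dominated by
lower-order terms whose coefficients depend on earlier steps and initial data only
(`ScalarRun.exists_length_bound`). -/

namespace ARpApprox

variable {n : ℕ}

/-! ### Negative curvature and the quadratic form of the Hessian -/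

/-- The set of eigenvalues is the spectrum of the matrix. -/
theorem setOf_hasEigenvalue_eq_spectrum (A : Matrix (Fin n) (Fin n) ℝ) :
    {μ : ℝ | Module.End.HasEigenvalue (Matrix.toLin' A) μ} = spectrum ℝ A := by
  ext μ
  rw [Set.mem_ofPred_eq, Module.End.hasEigenvalue_iff_mem_spectrum, Matrix.spectrum_toLin']

theorem lambdaMin_eq_sInf_spectrum (A : Matrix (Fin n) (Fin n) ℝ) :
    lambdaMin A = sInf (spectrum ℝ A) := by
  rw [lambdaMin, setOf_hasEigenvalue_eq_spectrum]

theorem lambdaMin_le {A : Matrix (Fin n) (Fin n) ℝ} {μ : ℝ} (h : μ ∈ spectrum ℝ A) :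
    lambdaMin A ≤ μ := by
  rw [lambdaMin_eq_sInf_spectrum]
  exact csInf_le (Matrix.finite_spectrum A).bddBelow h

open Matrix Pointwise in
/-- The leftmost eigenvalue bounds the quadratic form from below. -/
theorem lambdaMin_mul_le_dotProduct {A : Matrix (Fin n) (Fin n) ℝ} (hA : A.IsHermitian)
    (v : Fin n → ℝ) : lambdaMin A * (v ⬝ᵥ v) ≤ v ⬝ᵥ (A *ᵥ v) := by
  have hB : (A - lambdaMin A • (1 : Matrix (Fin n) (Fin n) ℝ)).IsHermitian := by
    refine hA.sub ?_
    rw [Matrix.IsHermitian, conjTranspose_smul, conjTranspose_one]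
    simp
  have hpos : (A - lambdaMin A • (1 : Matrix (Fin n) (Fin n) ℝ)).PosSemidef := by
    rw [hB.posSemidef_iff_eigenvalues_nonneg]
    intro i
    have h := hB.eigenvalues_mem_spectrum_real i
    have heq : spectrum ℝ (A - lambdaMin A • (1 : Matrix (Fin n) (Fin n) ℝ)) =
        spectrum ℝ A - ({lambdaMin A} : Set ℝ) := by
      rw [← Algebra.algebraMap_eq_smul_one, spectrum.sub_singleton_eq]
    rw [heq] at h
    obtain ⟨μ, hμ, c, hc, h⟩ := Set.mem_sub.1 h
    have := lambdaMin_le hμ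
    rw [Set.mem_singleton_iff] at hc
    simp only [Pi.zero_apply]
    linarith
  have h := hpos.dotProduct_mulVec_nonneg v
  simp only [star_trivial, sub_mulVec, smul_mulVec, one_mulVec, dotProduct_sub,
    dotProduct_smul, smul_eq_mul] at h
  linarith

open Matrix in
/-- The leftmost eigenvalue is attained by the quadratic form. -/
theorem exists_dotProduct_eq_lambdaMin [NeZero n] {A : Matrix (Fin n) (Fin n) ℝ}
    (hA : A.IsHermitian) : ∃ v : Fin n → ℝ, v ≠ 0 ∧ v ⬝ᵥ (A *ᵥ v) = lambdaMin A * (v ⬝ᵥ v) := by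
  have hne : (spectrum ℝ A).Nonempty := ⟨_, hA.eigenvalues_mem_spectrum_real 0⟩
  have hmem : lambdaMin A ∈ spectrum ℝ A := by
    rw [lambdaMin_eq_sInf_spectrum]
    exact hne.csInf_mem (Matrix.finite_spectrum A)
  rw [← setOf_hasEigenvalue_eq_spectrum] at hmem
  obtain ⟨v, hv⟩ := Module.End.HasEigenvalue.exists_hasEigenvector hmem
  refine ⟨v, hv.2, ?_⟩
  have := hv.apply_eq_smul
  rw [Matrix.toLin'_apply] at this
  rw [this, dotProduct_smul, smul_eq_mul]

open Matrix in
theorem dotProduct_hessianMatrix_mulVec (f : Vec n → ℝ) (x v : Vec n) :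
    v.ofLp ⬝ᵥ (hessianMatrix f x *ᵥ v.ofLp) = iteratedFDeriv ℝ 2 f x (fun _ => v) := by
  have hv : v = ∑ i, v i • EuclideanSpace.single i (1 : ℝ) := by
    ext j
    simp [Finset.sum_apply, Pi.single_apply]
  rw [iteratedFDeriv_two_apply]
  conv_rhs => rw [hv]
  simp only [map_sum, map_smul, _root_.sum_apply, _root_.smul_apply,
    dotProduct, mulVec, hessianMatrix, of_apply, iteratedFDeriv_two_apply, smul_eq_mul,
    Finset.mul_sum]
  rw [Finset.sum_comm]
  refine Finset.sum_congr rfl fun i _ => Finset.sum_congr rfl fun j _ => ?_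
  simp
  ring

theorem isHermitian_hessianMatrix {f : Vec n → ℝ} (hf : ContDiff ℝ 2 f) (x : Vec n) :
    (hessianMatrix f x).IsHermitian := by
  ext i j
  simp only [hessianMatrix, Matrix.conjTranspose_apply, Matrix.of_apply, star_trivial,
    iteratedFDeriv_two_apply]
  exact (hf.contDiffAt.isSymmSndFDerivAt (by simp)) _ _

theorem neg_iteratedFDeriv_two_le {f : Vec n → ℝ} (hf : ContDiff ℝ 2 f) (x v : Vec n) :
    -iteratedFDeriv ℝ 2 f x (fun _ => v) ≤ negCurvature f x * ‖v‖ ^ 2 := by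
  have h := lambdaMin_mul_le_dotProduct (isHermitian_hessianMatrix hf x) v.ofLp
  rw [dotProduct_hessianMatrix_mulVec] at h
  have hv : v.ofLp ⬝ᵥ v.ofLp = ‖v‖ ^ 2 := by
    rw [EuclideanSpace.real_norm_sq_eq]
    simp [dotProduct, sq]
  rw [hv] at h
  have := mul_le_mul_of_nonneg_right (le_max_right 0 (-lambdaMin (hessianMatrix f x)))
    (sq_nonneg ‖v‖)
  rw [negCurvature]
  linarith

/-- A lower bound on the quadratic form of the Hessian bounds the negative curvature. -/
theorem negCurvature_le {f : Vec n → ℝ} (hf : ContDiff ℝ 2 f) (x : Vec n) {c : ℝ}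
    (hc : 0 ≤ c) (h : ∀ v, -iteratedFDeriv ℝ 2 f x (fun _ => v) ≤ c * ‖v‖ ^ 2) :
    negCurvature f x ≤ c := by
  refine max_le hc ?_
  rcases Nat.eq_zero_or_pos n with rfl | hn
  -- In dimension zero the spectrum is empty and `sInf ∅ = 0`.
  · have : lambdaMin (hessianMatrix f x) = 0 := by
      rw [lambdaMin_eq_sInf_spectrum, spectrum.of_subsingleton, Real.sInf_empty]
    simpa [this]
  · have : NeZero n := ⟨hn.ne'⟩
    obtain ⟨v, hv, hveq⟩ := exists_dotProduct_eq_lambdaMin (isHermitian_hessianMatrix hf x)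
    have h1 := h (WithLp.toLp 2 v)
    rw [← dotProduct_hessianMatrix_mulVec] at h1
    have hv' : v ⬝ᵥ v = ‖WithLp.toLp 2 v‖ ^ 2 := by
      rw [EuclideanSpace.real_norm_sq_eq]
      simp [dotProduct, sq]
    rw [hveq, hv', ← neg_mul] at h1
    refine le_of_mul_le_mul_right h1 ?_
    have : WithLp.toLp 2 v ≠ 0 := by simpa using hv
    positivity

theorem negCurvature_nonneg (f : Vec n → ℝ) (x : Vec n) : 0 ≤ negCurvature f x :=
  le_max_left _ _

/-- The negative curvature is stable under perturbation of the Hessian. -/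
theorem negCurvature_le_add_norm {f g : Vec n → ℝ} (hf : ContDiff ℝ 2 f)
    (hg : ContDiff ℝ 2 g) (x y : Vec n) :
    negCurvature f x ≤
      negCurvature g y + ‖iteratedFDeriv ℝ 2 f x - iteratedFDeriv ℝ 2 g y‖ := by
  refine negCurvature_le hf x (add_nonneg (negCurvature_nonneg _ _) (norm_nonneg _)) fun v => ?_
  have h1 := neg_iteratedFDeriv_two_le hg y v
  have h2 := (iteratedFDeriv ℝ 2 f x - iteratedFDeriv ℝ 2 g y).le_opNorm (fun _ => v)
  rw [_root_.sub_apply, Real.norm_eq_abs] at h2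
  have h3 := neg_abs_le (iteratedFDeriv ℝ 2 f x (fun _ => v) - iteratedFDeriv ℝ 2 g y (fun _ => v))
  simp only [Finset.prod_const, Finset.card_univ, Fintype.card_fin] at h2
  linarith

/-! ### Derivatives of symmetric, homogeneous and diagonal maps -/

section Calculus

variable {E F : Type*} [NormedAddCommGroup E] [NormedSpace ℝ E] [NormedAddCommGroup F]
  [NormedSpace ℝ F]

/-- The third derivative of a `C³` function is symmetric. -/
theorem iteratedFDeriv_three_comp_perm {f : E → F} (hf : ContDiff ℝ 3 f) (x : E) (v : Fin 3 → E)
    (σ : Equiv.Perm (Fin 3)) :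
    iteratedFDeriv ℝ 3 f x (fun i => v (σ i)) = iteratedFDeriv ℝ 3 f x v := by
  have h3 : ∀ v : Fin 3 → E, iteratedFDeriv ℝ 3 f x v =
      fderiv ℝ (fderiv ℝ (fderiv ℝ f)) x (v 0) (v 1) (v 2) := fun v => by
    rw [iteratedFDeriv_succ_apply_right, iteratedFDeriv_two_apply]
    rfl
  have hf1 : ContDiff ℝ 2 (fderiv ℝ f) := hf.fderiv_right (by norm_num)
  have hf2 : ContDiff ℝ 1 (fderiv ℝ (fderiv ℝ f)) := hf1.fderiv_right (by norm_num)
  -- The first two slots commute by symmetry of the second derivative of `fderiv ℝ f`; the last two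
  -- by differentiating the symmetry of the second derivative of `f`. These two transpositions
  -- generate all permutations.
  have h01 : ∀ a b c, fderiv ℝ (fderiv ℝ (fderiv ℝ f)) x a b c =
      fderiv ℝ (fderiv ℝ (fderiv ℝ f)) x b a c := fun a b c => by
    rw [(hf1.contDiffAt.isSymmSndFDerivAt (by simp)) a b]
  have hd := (hf2.differentiable (by norm_num) x).hasFDerivAt
  have happ : ∀ a b c, fderiv ℝ (fderiv ℝ (fderiv ℝ f)) x a b c =
      fderiv ℝ (fun y => fderiv ℝ (fderiv ℝ f) y b c) x a := fun a b c => by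
    rw [((hd.clm_apply (hasFDerivAt_const b x)).clm_apply (hasFDerivAt_const c x)).fderiv]
    simp
  have h12 : ∀ a b c, fderiv ℝ (fderiv ℝ (fderiv ℝ f)) x a b c =
      fderiv ℝ (fderiv ℝ (fderiv ℝ f)) x a c b := fun a b c => by
    rw [happ, happ, funext fun y =>
      ((hf.of_le (by norm_num)).contDiffAt (n := 2) (x := y)).isSymmSndFDerivAt (by simp) b c]
  have hσ : ∀ σ : Equiv.Perm (Fin 3), (σ 0 = 0 ∧ σ 1 = 1 ∧ σ 2 = 2) ∨
      (σ 0 = 0 ∧ σ 1 = 2 ∧ σ 2 = 1) ∨ (σ 0 = 1 ∧ σ 1 = 0 ∧ σ 2 = 2) ∨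
      (σ 0 = 1 ∧ σ 1 = 2 ∧ σ 2 = 0) ∨ (σ 0 = 2 ∧ σ 1 = 0 ∧ σ 2 = 1) ∨
      (σ 0 = 2 ∧ σ 1 = 1 ∧ σ 2 = 0) := by decide
  rw [h3, h3]
  rcases hσ σ with ⟨h0, h1, h2⟩ | ⟨h0, h1, h2⟩ | ⟨h0, h1, h2⟩ | ⟨h0, h1, h2⟩ | ⟨h0, h1, h2⟩ |
    ⟨h0, h1, h2⟩ <;> rw [h0, h1, h2]
  · rw [h12]
  · rw [h01]
  · rw [h12, h01]
  · rw [h01, h12]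
  · rw [h01, h12, h01]

/-- If `f` is homogeneous of degree `q`, then its derivatives of the other orders vanish at the
origin. -/
theorem iteratedFDeriv_zero_of_homogeneous {f : E → F} (hf : ContDiff ℝ ⊤ f) {q i : ℕ}
    (hq : ∀ y, f ((2 : ℝ) • y) = (2 : ℝ) ^ q • f y) (hi : i ≠ q) :
    iteratedFDeriv ℝ i f 0 = 0 := by
  -- Differentiating `f (2y) = 2 ^ q f y` at the fixed point `0` gives `2 ^ q D = 2 ^ i D` for the
  -- `i`-th derivative `D`.
  have h1 := ((2 : ℝ) • ContinuousLinearMap.id ℝ E).iteratedFDeriv_comp_right hf 0 (i := i)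
    (by simp)
  have h2 : f ∘ ((2 : ℝ) • ContinuousLinearMap.id ℝ E) = (2 : ℝ) ^ q • f := by
    ext y
    simp [hq]
  rw [h2, iteratedFDeriv_const_smul_apply (hf.of_le (by simp)).contDiffAt] at h1
  ext v
  have h3 := congrArg (fun A => A v) h1
  simp only [smul_apply, ContinuousMultilinearMap.compContinuousLinearMap_apply,
    ContinuousLinearMap.id_apply, map_zero,
    ContinuousMultilinearMap.map_smul_univ, Finset.prod_const, Finset.card_univ,
    Fintype.card_fin] at h3
  rw [← sub_eq_zero, ← sub_smul, smul_eq_zero] at h3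
  rcases h3 with h3 | h3
  · exact absurd (pow_right_injective₀ (by norm_num : (0 : ℝ) < 2) (by norm_num)
      (sub_eq_zero.1 h3)) (Ne.symm hi)
  · simpa using h3

variable {q : ℕ} (A : ContinuousMultilinearMap ℝ (fun _ : Fin q => E) F)

theorem contDiff_diagonal {n : WithTop ℕ∞} : ContDiff ℝ n (fun y => A (fun _ => y)) :=
  A.contDiff.comp (contDiff_pi.2 fun _ => contDiff_id)

theorem iteratedFDeriv_diagonal_zero {i : ℕ} (hi : i ≠ q) :
    iteratedFDeriv ℝ i (fun y => A (fun _ => y)) 0 = 0 := by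
  refine iteratedFDeriv_zero_of_homogeneous (contDiff_diagonal A) (fun y => ?_) hi
  rw [ContinuousMultilinearMap.map_smul_univ A (fun _ => (2 : ℝ)) (fun _ => y)]
  simp

/-- The derivative of order `q` is the sum of `A` over all permutations of its arguments, hence
constant in the base point. -/
theorem iteratedFDeriv_diagonal_of_lt {i : ℕ} (hi : q < i) (y : E) :
    iteratedFDeriv ℝ i (fun y => A (fun _ => y)) y = 0 := by
  induction i, hi using Nat.le_induction generalizing y with
  | base =>
    have : iteratedFDeriv ℝ q (fun y => A (fun _ => y)) =
        fun _ => iteratedFDeriv ℝ q (fun y => A (fun _ => y)) 0 := by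
      ext y v
      rw [A.iteratedFDeriv_comp_diagonal, A.iteratedFDeriv_comp_diagonal]
    ext v
    rw [iteratedFDeriv_succ_apply_left, this, fderiv_fun_const]
    rfl
  | succ i hi ih =>
    ext v
    rw [iteratedFDeriv_succ_apply_left, funext ih, fderiv_fun_const]
    rfl

/-- Mean value inequality on a ball for derivatives vanishing at the origin. -/
theorem norm_iteratedFDeriv_le_of_succ {f : E → F} {i : ℕ} (hf : ContDiff ℝ (i + 1 : ℕ) f)
    (h0 : iteratedFDeriv ℝ i f 0 = 0) {r C : ℝ}
    (hC : ∀ y, ‖y‖ ≤ r → ‖iteratedFDeriv ℝ (i + 1) f y‖ ≤ C) {y : E} (hy : ‖y‖ ≤ r) :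
    ‖iteratedFDeriv ℝ i f y‖ ≤ C * r := by
  have hC0 : 0 ≤ C := (norm_nonneg _).trans (hC y hy)
  have h := (convex_closedBall (0 : E) r).norm_image_sub_le_of_norm_fderiv_le
    (f := iteratedFDeriv ℝ i f) (𝕜 := ℝ) (C := C) (x := 0) (y := y)
    (fun z _ => (hf.differentiable_iteratedFDeriv (by exact_mod_cast Nat.lt_succ_self i)) z)
    (fun z hz => by
      rw [norm_fderiv_iteratedFDeriv]
      exact hC z (by simpa using hz))
    (by simpa using (norm_nonneg y).trans hy) (by simpa using hy)
  rw [h0, sub_zero, sub_zero] at h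
  exact h.trans (mul_le_mul_of_nonneg_left hy hC0)

end Calculus

/-! ### The Taylor error with an approximate third-order tensor -/

theorem approxTaylor_three (f : Vec n → ℝ) (x : Vec n) (T : Tensor n 3) :
    approxTaylor f x T = (fun _ => f x) + (fun s => iteratedFDeriv ℝ 1 f x (fun _ => s)) +
      (1 / 2 : ℝ) • (fun s => iteratedFDeriv ℝ 2 f x (fun _ => s)) +
      (1 / 6 : ℝ) • (fun s => T (fun _ => s)) := by
  ext s
  simp [approxTaylor, Finset.sum_Icc_succ_top, Nat.factorial]
  ring

theorem approxTaylor_three_zero (f : Vec n → ℝ) (x : Vec n) (T : Tensor n 3) :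
    approxTaylor f x T 0 = f x := by
  have hA : ∀ {q : ℕ} [NeZero q] (A : Tensor n q), A (fun _ => 0) = 0 := fun A => A.map_zero
  simp [approxTaylor_three, hA]

theorem contDiff_approxTaylor_three (f : Vec n → ℝ) (x : Vec n) (T : Tensor n 3)
    {m : WithTop ℕ∞} : ContDiff ℝ m (approxTaylor f x T) := by
  rw [approxTaylor_three]
  exact ((contDiff_const.add (contDiff_diagonal (iteratedFDeriv ℝ 1 f x))).add
    ((contDiff_diagonal (iteratedFDeriv ℝ 2 f x)).const_smul (1 / 2 : ℝ))).add
    ((contDiff_diagonal T).const_smul (1 / 6 : ℝ))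

theorem iteratedFDeriv_approxTaylor_three (f : Vec n → ℝ) (x : Vec n) (T : Tensor n 3) {i : ℕ}
    (hi : i ≠ 0) (y : Vec n) :
    iteratedFDeriv ℝ i (approxTaylor f x T) y =
      iteratedFDeriv ℝ i (fun s => iteratedFDeriv ℝ 1 f x (fun _ => s)) y +
      (1 / 2 : ℝ) • iteratedFDeriv ℝ i (fun s => iteratedFDeriv ℝ 2 f x (fun _ => s)) y +
      (1 / 6 : ℝ) • iteratedFDeriv ℝ i (fun s => T (fun _ => s)) y := by
  have h1 := (contDiff_diagonal (iteratedFDeriv ℝ 1 f x) (n := i)).contDiffAt (x := y)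
  have h2 := (contDiff_diagonal (iteratedFDeriv ℝ 2 f x) (n := i)).contDiffAt (x := y)
  have h3 := (contDiff_diagonal T (n := i)).contDiffAt (x := y)
  have h0 : ContDiffAt ℝ i (fun _ : Vec n => f x) y := contDiffAt_const
  have h2' := h2.const_smul (1 / 2 : ℝ)
  have h3' := h3.const_smul (1 / 6 : ℝ)
  have h01 := h0.add h1
  have h012 := h01.add h2'
  rw [approxTaylor_three]
  refine (iteratedFDeriv_add_apply h012 h3').trans ?_
  refine congrArg₂ (· + ·) ?_ (iteratedFDeriv_const_smul_apply' h3)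
  refine (iteratedFDeriv_add_apply h01 h2').trans ?_
  refine congrArg₂ (· + ·) ?_ (iteratedFDeriv_const_smul_apply' h2)
  refine (iteratedFDeriv_add_apply h0 h1).trans ?_
  rw [iteratedFDeriv_const_of_ne hi]
  simp

/-- The error of the approximate Taylor expansion. -/
noncomputable def taylorError (f : Vec n → ℝ) (x : Vec n) (T : Tensor n 3) (y : Vec n) : ℝ :=
  f (x + y) - approxTaylor f x T y

theorem contDiff_taylorError {f : Vec n → ℝ} (hf : ContDiff ℝ 3 f) (x : Vec n) (T : Tensor n 3) :
    ContDiff ℝ 3 (taylorError f x T) :=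
  (hf.comp (contDiff_const.add contDiff_id)).sub (contDiff_approxTaylor_three f x T)

theorem iteratedFDeriv_taylorError {f : Vec n → ℝ} (hf : ContDiff ℝ 3 f) (x : Vec n)
    (T : Tensor n 3) {i : ℕ} (hi : i ≤ 3) (y : Vec n) :
    iteratedFDeriv ℝ i (taylorError f x T) y =
      iteratedFDeriv ℝ i f (x + y) - iteratedFDeriv ℝ i (approxTaylor f x T) y := by
  have h : ContDiff ℝ 3 (fun y => f (x + y)) := hf.comp (contDiff_const.add contDiff_id)
  rw [← iteratedFDeriv_comp_add_left]
  exact iteratedFDeriv_sub_apply (h.of_le (by exact_mod_cast hi)).contDiffAt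
    (contDiff_approxTaylor_three f x T).contDiffAt

/-- At the origin only the term of degree `i` contributes to the `i`-th derivative of the model, and
it contributes its symmetrization. For `i = 2` this is the Hessian itself, which is symmetric. -/
theorem iteratedFDeriv_taylorError_zero {f : Vec n → ℝ} (hf : ContDiff ℝ 3 f) (x : Vec n)
    (T : Tensor n 3) {i : ℕ} (hi : i < 3) : iteratedFDeriv ℝ i (taylorError f x T) 0 = 0 := by
  interval_cases i
  · ext v
    simp [taylorError, approxTaylor_three_zero]
  · rw [iteratedFDeriv_taylorError hf x T (by norm_num),
      iteratedFDeriv_approxTaylor_three f x T (by norm_num),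
      iteratedFDeriv_diagonal_zero (iteratedFDeriv ℝ 2 f x) (by norm_num),
      iteratedFDeriv_diagonal_zero T (by norm_num)]
    ext v
    simp only [_root_.sub_apply, _root_.add_apply, _root_.smul_apply,
      ContinuousMultilinearMap.iteratedFDeriv_comp_diagonal]
    simp [iteratedFDeriv_one_apply]
  · rw [iteratedFDeriv_taylorError hf x T (by norm_num),
      iteratedFDeriv_approxTaylor_three f x T (by norm_num),
      iteratedFDeriv_diagonal_zero (iteratedFDeriv ℝ 1 f x) (by norm_num),
      iteratedFDeriv_diagonal_zero T (by norm_num)]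
    have hs := ((hf.of_le (by norm_num)).contDiffAt (n := 2) (x := x)).isSymmSndFDerivAt
      (by simp)
    ext v
    simp only [_root_.sub_apply, _root_.add_apply, _root_.smul_apply, add_zero,
      ContinuousMultilinearMap.iteratedFDeriv_comp_diagonal]
    have hu : (Finset.univ : Finset (Equiv.Perm (Fin 2))) = {1, Equiv.swap 0 1} := by decide
    rw [hu, Finset.sum_pair (by decide)]
    simp only [iteratedFDeriv_two_apply]
    change fderiv ℝ (fderiv ℝ f) x (v 0) (v 1) - (0 + (1 / 2 : ℝ) *
      (fderiv ℝ (fderiv ℝ f) x (v 0) (v 1) + fderiv ℝ (fderiv ℝ f) x (v 1) (v 0)) +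
        (1 / 6 : ℝ) * 0) = 0
    rw [hs (v 1) (v 0)]
    ring

/-- `T` need not be symmetric, so the model's third derivative is only the symmetrization of `T`. As
that of `f` is symmetric, the error is the symmetrization of `∇³f(x + y) - T`, and averaging over
permutations does not increase the norm. -/
theorem norm_iteratedFDeriv_three_taylorError_le {f : Vec n → ℝ} (hf : ContDiff ℝ 3 f)
    (x : Vec n) (T : Tensor n 3) (y : Vec n) :
    ‖iteratedFDeriv ℝ 3 (taylorError f x T) y‖ ≤ ‖iteratedFDeriv ℝ 3 f (x + y) - T‖ := by
  refine ContinuousMultilinearMap.opNorm_le_bound (norm_nonneg _) fun v => ?_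
  have heq : iteratedFDeriv ℝ 3 (taylorError f x T) y v =
      (1 / 6 : ℝ) * ∑ σ : Equiv.Perm (Fin 3),
        (iteratedFDeriv ℝ 3 f (x + y) - T) (fun i => v (σ i)) := by
    rw [iteratedFDeriv_taylorError hf x T le_rfl,
      iteratedFDeriv_approxTaylor_three f x T (by norm_num),
      iteratedFDeriv_diagonal_of_lt (iteratedFDeriv ℝ 1 f x) (by norm_num),
      iteratedFDeriv_diagonal_of_lt (iteratedFDeriv ℝ 2 f x) (by norm_num)]
    simp only [_root_.sub_apply, _root_.smul_apply, smul_zero, zero_add,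
      ContinuousMultilinearMap.iteratedFDeriv_comp_diagonal, Finset.sum_sub_distrib,
      iteratedFDeriv_three_comp_perm hf, Finset.sum_const, Finset.card_univ, Fintype.card_perm,
      Fintype.card_fin, smul_eq_mul, nsmul_eq_mul]
    norm_num [Nat.factorial]
    ring
  have hσ : ∀ σ : Equiv.Perm (Fin 3), ‖(iteratedFDeriv ℝ 3 f (x + y) - T) (fun i => v (σ i))‖ ≤
      ‖iteratedFDeriv ℝ 3 f (x + y) - T‖ * ∏ i, ‖v i‖ := fun σ => by
    refine (ContinuousMultilinearMap.le_opNorm _ _).trans_eq ?_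
    rw [Equiv.prod_comp σ (fun i => ‖v i‖)]
  rw [heq, norm_mul]
  have hsum := (norm_sum_le _ _).trans (Finset.sum_le_sum fun σ (_ : σ ∈ Finset.univ) => hσ σ)
  simp only [Finset.sum_const, Finset.card_univ, Fintype.card_perm,
      Fintype.card_fin, nsmul_eq_mul] at hsum
  norm_num [Nat.factorial] at hsum ⊢
  linarith

/-- Taylor's inequality for the value, the gradient and the Hessian. -/
theorem norm_iteratedFDeriv_taylorError_le {f : Vec n → ℝ} (hf : ContDiff ℝ 3 f) {L : ℝ}
    (hL : LipschitzTensor 3 f L) (x : Vec n) (T : Tensor n 3) {i : ℕ} (hi : i ≤ 3) (s : Vec n) :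
    ‖iteratedFDeriv ℝ i (taylorError f x T) s‖ ≤
      (‖T - iteratedFDeriv ℝ 3 f x‖ + L * ‖s‖) * ‖s‖ ^ (3 - i) := by
  -- Descend from order 3 on the ball of radius `‖s‖`: each lower derivative vanishes at the origin,
  -- so the mean value inequality costs one factor `‖s‖`.
  suffices h : ∀ j ≤ 3, ∀ y : Vec n, ‖y‖ ≤ ‖s‖ →
      ‖iteratedFDeriv ℝ (3 - j) (taylorError f x T) y‖ ≤
        (‖T - iteratedFDeriv ℝ 3 f x‖ + L * ‖s‖) * ‖s‖ ^ j by
    have := h (3 - i) (by omega) s le_rfl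
    rwa [Nat.sub_sub_self hi] at this
  intro j
  induction j with
  | zero =>
    intro _ y hy
    refine (norm_iteratedFDeriv_three_taylorError_le hf x T y).trans ?_
    have h1 := hL.2 (x + y) x
    have h2 := norm_sub_le_norm_sub_add_norm_sub (iteratedFDeriv ℝ 3 f (x + y))
      (iteratedFDeriv ℝ 3 f x) T
    rw [add_sub_cancel_left] at h1
    rw [norm_sub_rev T]
    have h3 := mul_le_mul_of_nonneg_left hy (by linarith [hL.1] : 0 ≤ L)
    simp only [pow_zero, mul_one]
    linarith
  | succ j ih =>
    intro hj y hy
    have hij : 3 - (j + 1) + 1 = 3 - j := by omega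
    rw [pow_succ, ← mul_assoc]
    refine norm_iteratedFDeriv_le_of_succ ?_
      (iteratedFDeriv_taylorError_zero hf x T (by omega)) (fun z hz => ?_) hy
    · exact (contDiff_taylorError hf x T).of_le (by exact_mod_cast (by omega))
    · rw [hij]
      exact ih (by omega) z hz

/-! ### Window sums of step lengths -/

/-- The sum of `N` consecutive terms of `ℓ` ending with `ℓ j`. -/
noncomputable def windowSum (N : ℕ) (ℓ : ℤ → ℝ) (j : ℤ) : ℝ :=
  ∑ i ∈ Finset.range N, ℓ (j - i)

section Window

variable {N : ℕ} {ℓ : ℤ → ℝ}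

theorem windowSum_nonneg (h0 : ∀ j, 0 ≤ ℓ j) (j : ℤ) : 0 ≤ windowSum N ℓ j :=
  Finset.sum_nonneg fun _ _ => h0 _

theorem windowSum_succ (N : ℕ) (ℓ : ℤ → ℝ) (j : ℤ) :
    windowSum (N + 1) ℓ j = windowSum N ℓ (j - 1) + ℓ j := by
  rw [windowSum, Finset.sum_range_succ', windowSum]
  simp [sub_sub, add_comm]

theorem windowSum_mono (h0 : ∀ j, 0 ≤ ℓ j) {M : ℕ} (h : N ≤ M) (j : ℤ) :
    windowSum N ℓ j ≤ windowSum M ℓ j :=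
  Finset.sum_le_sum_of_subset_of_nonneg (Finset.range_mono h) fun _ _ _ => h0 _

theorem windowSum_le {R : ℝ} {j : ℤ} (h : ∀ i ≤ j, ℓ i ≤ R) : windowSum N ℓ j ≤ N * R := by
  have := Finset.sum_le_card_nsmul (Finset.range N) (fun i : ℕ => ℓ (j - i)) R
    fun i _ => h _ (by omega)
  simpa [windowSum] using this

/-- Each unit shift brings in one term of negative index, equal to 1, and drops a nonnegative term
at the other end. -/
theorem sum_shift_pow_le (hneg : ∀ j < 0, ℓ j = 1) (h0 : ∀ j, 0 ≤ ℓ j) (q i k : ℕ) :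
    ∑ j ∈ Finset.range k, ℓ ((j : ℤ) - i) ^ q ≤ i + ∑ j ∈ Finset.range k, ℓ j ^ q := by
  induction i with
  | zero => simp
  | succ i ih =>
    have h1 : ∑ j ∈ Finset.range k, ℓ ((j : ℤ) - (i + 1 : ℕ)) ^ q ≤
        ∑ j ∈ Finset.range (k + 1), ℓ ((j : ℤ) - (i + 1 : ℕ)) ^ q := by
      rw [Finset.sum_range_succ]
      exact le_add_of_nonneg_right (pow_nonneg (h0 _) _)
    rw [Finset.sum_range_succ', hneg _ (by push_cast; omega)] at h1
    have h2 : ∀ j : ℕ, ((j + 1 : ℕ) : ℤ) - (i + 1 : ℕ) = j - i := fun j => by push_cast; ring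
    simp only [h2, one_pow] at h1
    rw [Nat.cast_succ (R := ℝ)]
    linarith

/-- The power mean inequality costs `N ^ 3`; the other factor `N` counts the shifted sums, each at
most `N` plus the unshifted one. -/
theorem sum_windowSum_pow_four_le (hneg : ∀ j < 0, ℓ j = 1) (h0 : ∀ j, 0 ≤ ℓ j) (k : ℕ) :
    ∑ j ∈ Finset.range k, windowSum N ℓ j ^ 4 ≤
      (N : ℝ) ^ 4 * (N + ∑ j ∈ Finset.range k, ℓ j ^ 4) := by
  have h1 : ∀ j : ℤ, windowSum N ℓ j ^ 4 ≤
      (N : ℝ) ^ 3 * ∑ i ∈ Finset.range N, ℓ (j - i) ^ 4 := fun j => by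
    have := pow_sum_le_card_mul_sum_pow (s := Finset.range N) (f := fun i : ℕ => ℓ (j - i))
      (fun i _ => h0 _) 3
    rwa [Finset.card_range] at this
  refine (Finset.sum_le_sum fun (j : ℕ) _ => h1 j).trans ?_
  rw [← Finset.mul_sum, Finset.sum_comm, pow_succ (N : ℝ) 3, mul_assoc]
  refine mul_le_mul_of_nonneg_left ?_ (by positivity)
  have h2 := Finset.sum_le_card_nsmul (Finset.range N)
    (fun i : ℕ => ∑ j ∈ Finset.range k, ℓ ((j : ℤ) - i) ^ 4) (N + ∑ j ∈ Finset.range k, ℓ j ^ 4)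
    fun i hi => (sum_shift_pow_le hneg h0 4 i k).trans (by
      have : (i : ℝ) ≤ N := by exact_mod_cast (Finset.mem_range.1 hi).le
      linarith)
  rwa [Finset.card_range, nsmul_eq_mul] at h2

end Window

/-! ### The scalar recursion: boundedness of `σ` and the rates -/

/-- The scalar relations between step lengths `ℓ`, regularization parameters `σ`, objective
values `F`, gradient norms `g` and negative curvatures `c` along a run. -/
structure ScalarRun (N : ℕ) (σ₀ θ₁ θ₂ E κ Δ G B : ℝ) (ℓ : ℤ → ℝ) (σ F g c : ℕ → ℝ) : Prop where
  length_nonneg : ∀ j, 0 ≤ ℓ j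
  length_neg : ∀ j < 0, ℓ j = 1
  σ_zero : σ 0 = σ₀
  σ_succ : ∀ k, σ (k + 1) = σ k + σ k * ℓ k ^ 4
  lower : ∀ k, F 0 - F k ≤ Δ
  g_zero : g 0 ≤ G
  c_zero : c 0 ≤ B
  g_nonneg : ∀ k, 0 ≤ g k
  c_nonneg : ∀ k, 0 ≤ c k
  decrease : ∀ k, σ k / 24 * ℓ k ^ 4 ≤ F k - F (k + 1) + E * windowSum N ℓ k ^ 4
  g_succ : ∀ k, g (k + 1) ≤ (θ₁ * σ k + E) * windowSum N ℓ k ^ 3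
  c_succ : ∀ k, c (k + 1) ≤ (θ₂ * σ k + E) * windowSum N ℓ k ^ 2
  -- The window ends at `k - 1`, so the cubic coefficient involves only earlier steps; this is what
  -- makes a bound on `ℓ k` by the past possible.
  step : ∀ k : ℕ, σ k / 24 * ℓ k ^ 4 ≤
    g k * ℓ k + c k * ℓ k ^ 2 + (κ + E * windowSum N ℓ ((k : ℤ) - 1)) * ℓ k ^ 3

namespace ScalarRun

variable {N : ℕ} {σ₀ θ₁ θ₂ E κ Δ G B : ℝ} {ℓ : ℤ → ℝ} {σ F g c : ℕ → ℝ}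

theorem sum_mul_pow_four (h : ScalarRun N σ₀ θ₁ θ₂ E κ Δ G B ℓ σ F g c) (k : ℕ) :
    ∑ j ∈ Finset.range k, σ j * ℓ j ^ 4 = σ k - σ₀ := by
  rw [← h.σ_zero, ← Finset.sum_range_sub]
  exact Finset.sum_congr rfl fun j _ => by rw [h.σ_succ]; ring

theorem le_σ (h : ScalarRun N σ₀ θ₁ θ₂ E κ Δ G B ℓ σ F g c) (hσ₀ : 0 < σ₀) (k : ℕ) :
    σ₀ ≤ σ k := by
  induction k with
  | zero => exact h.σ_zero.ge
  | succ k ih =>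
    rw [h.σ_succ]
    have := mul_nonneg (hσ₀.le.trans ih) (pow_nonneg (h.length_nonneg k) 4)
    linarith

theorem σ_le_succ (h : ScalarRun N σ₀ θ₁ θ₂ E κ Δ G B ℓ σ F g c) (hσ₀ : 0 < σ₀) (k : ℕ) :
    σ k ≤ σ (k + 1) := by
  rw [h.σ_succ]
  have := mul_nonneg (hσ₀.le.trans (h.le_σ hσ₀ k)) (pow_nonneg (h.length_nonneg k) 4)
  linarith

theorem sum_pow_four_le (h : ScalarRun N σ₀ θ₁ θ₂ E κ Δ G B ℓ σ F g c) (hσ₀ : 0 < σ₀) (k : ℕ) :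
    ∑ j ∈ Finset.range k, ℓ j ^ 4 ≤ σ k / σ₀ := by
  rw [le_div_iff₀ hσ₀, Finset.sum_mul]
  have h1 : ∑ j ∈ Finset.range k, ℓ j ^ 4 * σ₀ ≤ ∑ j ∈ Finset.range k, σ j * ℓ j ^ 4 :=
    Finset.sum_le_sum fun j _ => by
      rw [mul_comm]
      exact mul_le_mul_of_nonneg_right (h.le_σ hσ₀ j) (pow_nonneg (h.length_nonneg j) 4)
  rw [h.sum_mul_pow_four] at h1
  linarith

/-- The decrease of the objective bounds the growth of `σ`. -/
theorem σ_le_sum (h : ScalarRun N σ₀ θ₁ θ₂ E κ Δ G B ℓ σ F g c) (hE : 0 ≤ E) (k : ℕ) :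
    σ k ≤ σ₀ + 24 * Δ + 24 * E * N ^ 5 +
      24 * E * N ^ 4 * ∑ j ∈ Finset.range k, ℓ j ^ 4 := by
  have h1 := Finset.sum_le_sum fun j (_ : j ∈ Finset.range k) => h.decrease j
  rw [Finset.sum_add_distrib, Finset.sum_range_sub', ← Finset.mul_sum] at h1
  have h2 := h.sum_mul_pow_four k
  have h3 : ∑ j ∈ Finset.range k, σ j / 24 * ℓ j ^ 4 =
      (∑ j ∈ Finset.range k, σ j * ℓ j ^ 4) / 24 := by
    rw [Finset.sum_div]
    exact Finset.sum_congr rfl fun j _ => by ring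
  have h4 := mul_le_mul_of_nonneg_left
    (sum_windowSum_pow_four_le (N := N) h.length_neg h.length_nonneg k) hE
  have h5 := h.lower k
  rw [h3, h2] at h1
  linear_combination 24 * h1 + 24 * h4 + 24 * h5

/-- The steps taken before `σ` exceeds a threshold have bounded length. -/
theorem exists_length_bound (N : ℕ) {σ₀ θ₁ θ₂ E κ : ℝ} (G B S : ℝ) (hσ₀ : 0 < σ₀) (hθ₁ : 0 ≤ θ₁)
    (hθ₂ : 0 ≤ θ₂) (hE : 0 ≤ E) (hκ : 0 ≤ κ) :
    ∃ R : ℝ, ∀ {Δ : ℝ} {ℓ : ℤ → ℝ} {σ F g c : ℕ → ℝ},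
      ScalarRun N σ₀ θ₁ θ₂ E κ Δ G B ℓ σ F g c → ∀ k, σ k < S → ℓ k ≤ R := by
  -- `R₀` bounds the lengths before step `k`, `G'` and `B'` the gradient and the curvature at `x k`.
  -- The absolute values are there because no signs are known until a run is given.
  set R₀ : ℝ := 1 + S / σ₀ with hR₀
  set G' : ℝ := |G| + (θ₁ * |S| + E) * (N * R₀) ^ 3 with hG'
  set B' : ℝ := |B| + (θ₂ * |S| + E) * (N * R₀) ^ 2 with hB'
  refine ⟨1 + 24 * (G' + B' + κ + E * (N * R₀)) / σ₀, fun {Δ ℓ σ F g c} h k hk => ?_⟩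
  have hS : 0 < S := hσ₀.trans_le ((h.le_σ hσ₀ k).trans hk.le)
  have hR₀1 : 1 ≤ R₀ := by rw [hR₀]; linarith [div_pos hS hσ₀]
  have hℓ : ∀ i : ℤ, i ≤ (k : ℤ) - 1 → ℓ i ≤ R₀ := fun i hi => by
    rcases lt_or_ge i 0 with hi0 | hi0
    · rw [h.length_neg i hi0]; exact hR₀1
    · lift i to ℕ using hi0
      have h1 := Finset.single_le_sum (f := fun j : ℕ => ℓ j ^ 4) (s := Finset.range k)
        (fun j _ => pow_nonneg (h.length_nonneg j) 4) (Finset.mem_range.2 (by omega : i < k))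
      have h2 := h.sum_pow_four_le hσ₀ k
      have h3 : σ k / σ₀ ≤ S / σ₀ := div_le_div_of_nonneg_right hk.le hσ₀.le
      have h4 : ℓ i ^ 4 ≤ R₀ := by linarith
      by_contra! hcon
      have h5 : ℓ i ≤ ℓ i ^ 4 := le_self_pow₀ (hR₀1.trans hcon.le) (by norm_num)
      linarith
  have hw : ∀ j : ℤ, j ≤ (k : ℤ) - 1 → windowSum N ℓ j ≤ N * R₀ := fun j hj =>
    windowSum_le fun i hi => hℓ i (hi.trans hj)
  have hw0 := windowSum_nonneg (N := N) h.length_nonneg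
  have hNR : 0 ≤ N * R₀ := by positivity
  have hG'0 : 0 ≤ G' := by positivity
  have hB'0 : 0 ≤ B' := by positivity
  have hg : g k ≤ G' ∧ c k ≤ B' := by
    cases k with
    | zero =>
      refine ⟨(h.g_zero.trans (le_abs_self G)).trans (le_add_of_nonneg_right (by positivity)),
        (h.c_zero.trans (le_abs_self B)).trans (le_add_of_nonneg_right (by positivity))⟩
    | succ k =>
      have hσS : σ k ≤ |S| := ((h.σ_le_succ hσ₀ k).trans hk.le).trans (le_abs_self S)
      have hwk := hw k (by push_cast; omega)
      constructor
      · refine (h.g_succ k).trans (le_trans ?_ (le_add_of_nonneg_left (abs_nonneg G)))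
        have := hw0 k
        gcongr
      · refine (h.c_succ k).trans (le_trans ?_ (le_add_of_nonneg_left (abs_nonneg B)))
        have := hw0 k
        gcongr
  -- Telescoping up to `σ k` says nothing about `ℓ k`. If `ℓ k > 1`, every term on the right of
  -- `step` is at most a constant times `ℓ k ^ 3`; dividing by this cube leaves a linear bound.
  rcases le_or_gt (ℓ k) 1 with h1 | h1
  · exact h1.trans (le_add_of_nonneg_right (by positivity))
  · have hr3 : 0 < ℓ k ^ 3 := by positivity
    have hr1 : ℓ k ≤ ℓ k ^ 3 := le_self_pow₀ h1.le (by norm_num)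
    have hr2 : ℓ k ^ 2 ≤ ℓ k ^ 3 := pow_le_pow_right₀ h1.le (by norm_num)
    have hK : κ + E * windowSum N ℓ ((k : ℤ) - 1) ≤ κ + E * (N * R₀) := by
      have := hw _ le_rfl
      gcongr
    have e1 : g k * ℓ k ≤ G' * ℓ k ^ 3 := mul_le_mul hg.1 hr1 (by positivity) hG'0
    have e2 : c k * ℓ k ^ 2 ≤ B' * ℓ k ^ 3 := mul_le_mul hg.2 hr2 (by positivity) hB'0
    have e3 := mul_le_mul_of_nonneg_right hK hr3.le
    have e4 := h.step k
    have e5 : σ₀ / 24 * ℓ k ^ 4 ≤ σ k / 24 * ℓ k ^ 4 := by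
      have := h.le_σ hσ₀ k
      gcongr
    have e6 : σ₀ / 24 * ℓ k * ℓ k ^ 3 ≤ (G' + B' + κ + E * (N * R₀)) * ℓ k ^ 3 := by
      linear_combination e1 + e2 + e3 + e4 + e5
    have e7 := le_of_mul_le_mul_right e6 hr3
    have e8 : ℓ k ≤ 24 * (G' + B' + κ + E * (N * R₀)) / σ₀ := by
      rw [le_div_iff₀ hσ₀]
      linarith
    linarith

open Classical in
/-- The regularization parameters stay bounded. -/
theorem exists_σ_bound (N : ℕ) {σ₀ θ₁ θ₂ E κ : ℝ} (Δ G B : ℝ) (hσ₀ : 0 < σ₀) (hθ₁ : 0 ≤ θ₁)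
    (hθ₂ : 0 ≤ θ₂) (hE : 0 ≤ E) (hκ : 0 ≤ κ) :
    ∃ σmax : ℝ, ∀ {ℓ : ℤ → ℝ} {σ F g c : ℕ → ℝ},
      ScalarRun N σ₀ θ₁ θ₂ E κ Δ G B ℓ σ F g c → ∀ k, σ k ≤ σmax := by
  set a : ℝ := σ₀ + 24 * Δ + 24 * E * N ^ 5
  set b : ℝ := 24 * E * N ^ 4
  have hb : 0 ≤ b := by positivity
  -- Chosen so that `b / S ≤ 1 / 2`, which allows the absorption below.
  set S : ℝ := 2 * b + 1
  have hS : 0 < S := by positivity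
  obtain ⟨R, hR⟩ := exists_length_bound N G B S hσ₀ hθ₁ hθ₂ hE hκ
  set M : ℝ := S / σ₀ + R ^ 4
  have hM : 0 ≤ M := by positivity
  refine ⟨2 * (a + b * M), fun {ℓ σ F g c} h k => ?_⟩
  have hsmall : ∀ k, ∑ j ∈ Finset.range k, (if σ j < S then ℓ j ^ 4 else 0) ≤ M := by
    intro k
    induction k with
    | zero => simpa using hM
    | succ k ih =>
      rw [Finset.sum_range_succ]
      split_ifs with hk
      -- If `σ k < S`, all earlier steps together are controlled by `σ k / σ₀`, so only this step
      -- needs the bound `R`.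
      · refine add_le_add ?_ (pow_le_pow_left₀ (h.length_nonneg k) (hR h k hk) 4)
        refine (Finset.sum_le_sum fun j _ => ?_).trans ((h.sum_pow_four_le hσ₀ k).trans
          (div_le_div_of_nonneg_right hk.le hσ₀.le))
        split_ifs
        · exact le_rfl
        · exact pow_nonneg (h.length_nonneg j) 4
      · simpa using ih
  have hsum : ∑ j ∈ Finset.range k, ℓ j ^ 4 ≤ M + (σ k - σ₀) / S := by
    have h1 : ∑ j ∈ Finset.range k, ℓ j ^ 4 ≤ ∑ j ∈ Finset.range k,
        ((if σ j < S then ℓ j ^ 4 else 0) + σ j * ℓ j ^ 4 / S) :=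
      Finset.sum_le_sum fun j _ => by
        have h4 := pow_nonneg (h.length_nonneg j) 4
        have hσj := hσ₀.le.trans (h.le_σ hσ₀ j)
        split_ifs with hj
        · exact le_add_of_nonneg_right (by positivity)
        -- For `σ j ≥ S`, `ℓ j ^ 4` is at most `σ j * ℓ j ^ 4 / S`, whose sum telescopes.
        · rw [zero_add, le_div_iff₀ hS, mul_comm]
          exact mul_le_mul_of_nonneg_right (not_lt.1 hj) h4
    rw [Finset.sum_add_distrib, ← Finset.sum_div, h.sum_mul_pow_four] at h1
    linarith [hsmall k]
  have h1 := h.σ_le_sum hE k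
  have h2 : b * ((σ k - σ₀) / S) ≤ σ k / 2 := by
    have h3 := h.le_σ hσ₀ k
    rw [mul_div_assoc', div_le_iff₀ hS]
    have : b * σ₀ ≥ 0 := by positivity
    linear_combination this + 1 / 2 * (hσ₀.le.trans h3)
  have h3 := mul_le_mul_of_nonneg_left hsum hb
  have h4 : σ k ≤ a + b * ∑ j ∈ Finset.range k, ℓ j ^ 4 := h1
  linarith

/-- The complexity bound in terms of the scalar relations. -/
theorem exists_rate (N : ℕ) {σ₀ θ₁ θ₂ E κ : ℝ} (Δ G B : ℝ) (hσ₀ : 0 < σ₀) (hθ₁ : 0 ≤ θ₁)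
    (hθ₂ : 0 ≤ θ₂) (hE : 0 ≤ E) (hκ : 0 ≤ κ) :
    ∃ C₁ C₂ : ℝ, ∀ {ℓ : ℤ → ℝ} {σ F g c : ℕ → ℝ},
      ScalarRun N σ₀ θ₁ θ₂ E κ Δ G B ℓ σ F g c → ∀ k : ℕ, ∃ j ≤ k,
        g (j + 1) ≤ C₁ / ((k : ℝ) + 1) ^ (3 / 4 : ℝ) ∧
        c (j + 1) ≤ C₂ / ((k : ℝ) + 1) ^ (1 / 2 : ℝ) := by
  obtain ⟨σmax, hσmax⟩ := exists_σ_bound N Δ G B hσ₀ hθ₁ hθ₂ hE hκ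
  set W : ℝ := N ^ 4 * (N + σmax / σ₀)
  refine ⟨(θ₁ * σmax + E) * W ^ (3 / 4 : ℝ), (θ₂ * σmax + E) * W ^ (1 / 2 : ℝ),
    fun {ℓ σ F g c} h k => ?_⟩
  have hσpos : ∀ k, 0 ≤ σ k := fun k => hσ₀.le.trans (h.le_σ hσ₀ k)
  have hmax0 : 0 ≤ σmax := (hσpos 0).trans (hσmax h 0)
  have hW0 : 0 ≤ W := by positivity
  have hw0 := windowSum_nonneg (N := N) h.length_nonneg
  have hsum : ∑ j ∈ Finset.range (k + 1), windowSum N ℓ j ^ 4 ≤ W := by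
    refine (sum_windowSum_pow_four_le h.length_neg h.length_nonneg _).trans ?_
    have h1 := h.sum_pow_four_le hσ₀ (k + 1)
    have h2 : σ (k + 1) / σ₀ ≤ σmax / σ₀ := div_le_div_of_nonneg_right (hσmax h _) hσ₀.le
    exact mul_le_mul_of_nonneg_left (add_le_add le_rfl (h1.trans h2)) (by positivity)
  -- Some term is at most the average; the same `j` serves both rates, through the powers `3 / 4`
  -- and `2 / 4` of this bound.
  obtain ⟨j, hj, hjle⟩ : ∃ j ∈ Finset.range (k + 1), windowSum N ℓ j ^ 4 ≤ W / (k + 1) := by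
    refine Finset.exists_le_of_sum_le (by simp) (hsum.trans_eq ?_)
    rw [Finset.sum_const, Finset.card_range, nsmul_eq_mul]
    push_cast
    field_simp
  have hwj := hw0 j
  have hk : (0 : ℝ) ≤ (k : ℝ) + 1 := by positivity
  have hpow : ∀ q : ℕ, windowSum N ℓ j ^ q ≤
      W ^ ((q : ℝ) / 4) / ((k : ℝ) + 1) ^ ((q : ℝ) / 4) := fun q => by
    rw [← Real.div_rpow hW0 hk]
    have h1 := Real.rpow_le_rpow (by positivity) hjle (by positivity : (0 : ℝ) ≤ (q : ℝ) / 4)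
    rw [← Real.rpow_natCast, ← Real.rpow_mul hwj] at h1
    rwa [show ((4 : ℕ) : ℝ) * ((q : ℝ) / 4) = q by push_cast; ring, Real.rpow_natCast] at h1
  have h3 := hpow 3
  have h2 := hpow 2
  norm_num at h3 h2
  have hσj := hσmax h j
  have hσj0 := hσpos j
  refine ⟨j, Nat.lt_succ_iff.1 (Finset.mem_range.1 hj), ?_, ?_⟩
  · refine (h.g_succ j).trans ?_
    rw [mul_div_assoc]
    exact mul_le_mul (by gcongr) h3 (by positivity) (by positivity)
  · refine (h.c_succ j).trans ?_
    rw [mul_div_assoc]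
    exact mul_le_mul (by gcongr) h2 (by positivity) (by positivity)

end ScalarRun

/-! ### Averaged tensors and step lengths -/

/-- The averaged tensor is close to the tensor at every point close to the segment. -/
theorem norm_averagedTensor_sub_le {f : Vec n → ℝ} (hf : ContDiff ℝ 3 f) {L : ℝ}
    (hL : LipschitzTensor 3 f L) (x s z : Vec n)
    (hz : ∀ t : ℝ, 0 ≤ t → t ≤ 1 → ‖x + t • s - z‖ ≤ ‖s‖) :
    ‖averagedTensor 3 f x s - iteratedFDeriv ℝ 3 f z‖ ≤ L * ‖s‖ := by
  have hcont : Continuous fun t : ℝ => iteratedFDeriv ℝ 3 f (x + t • s) :=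
    (hf.continuous_iteratedFDeriv (by norm_num)).comp (by fun_prop)
  have hconst : iteratedFDeriv ℝ 3 f z = ∫ _ in (0 : ℝ)..1, iteratedFDeriv ℝ 3 f z := by simp
  rw [averagedTensor, hconst, ← intervalIntegral.integral_sub (hcont.intervalIntegrable _ _)
    intervalIntegrable_const]
  refine (intervalIntegral.norm_integral_le_of_norm_le_const (C := L * ‖s‖)
    fun t ht => ?_).trans_eq (by simp)
  rw [Set.uIoc_of_le zero_le_one] at ht
  exact (hL.2 _ _).trans (mul_le_mul_of_nonneg_left (hz t ht.1.le ht.2) (by linarith [hL.1]))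

theorem norm_averagedTensor_sub_left_le {f : Vec n → ℝ} (hf : ContDiff ℝ 3 f) {L : ℝ}
    (hL : LipschitzTensor 3 f L) (x s : Vec n) :
    ‖averagedTensor 3 f x s - iteratedFDeriv ℝ 3 f x‖ ≤ L * ‖s‖ := by
  refine norm_averagedTensor_sub_le hf hL x s x fun t h0 h1 => ?_
  rw [add_sub_cancel_left, norm_smul, Real.norm_of_nonneg h0]
  exact mul_le_of_le_one_left (norm_nonneg s) h1

theorem norm_averagedTensor_sub_right_le {f : Vec n → ℝ} (hf : ContDiff ℝ 3 f) {L : ℝ}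
    (hL : LipschitzTensor 3 f L) (x s : Vec n) :
    ‖averagedTensor 3 f x s - iteratedFDeriv ℝ 3 f (x + s)‖ ≤ L * ‖s‖ := by
  refine norm_averagedTensor_sub_le hf hL x s (x + s) fun t h0 h1 => ?_
  have : x + t • s - (x + s) = (t - 1) • s := by rw [sub_smul, one_smul]; abel
  rw [this, norm_smul, Real.norm_eq_abs]
  exact mul_le_of_le_one_left (norm_nonneg s) (abs_le.2 ⟨by linarith, by linarith⟩)

theorem stepLength_nonneg (s : ℕ → Vec n) (j : ℤ) : 0 ≤ stepLength s j := by
  rw [stepLength]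
  split_ifs <;> positivity

theorem stepLength_natCast (s : ℕ → Vec n) (k : ℕ) : stepLength s (k : ℤ) = ‖s k‖ := by
  simp [stepLength]

theorem stepLength_of_neg (s : ℕ → Vec n) {j : ℤ} (hj : j < 0) : stepLength s j = 1 :=
  if_pos hj

theorem sum_Icc_stepLength (s : ℕ → Vec n) (m : ℕ) (k : ℤ) :
    ∑ i ∈ Finset.Icc 1 m, stepLength s (k - (i : ℤ)) = windowSum m (stepLength s) (k - 1) := by
  rw [windowSum, ← Finset.Ico_add_one_right_eq_Icc, Finset.sum_Ico_eq_sum_range]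
  refine Finset.sum_congr (by simp) fun i _ => ?_
  congr 1
  push_cast
  ring

theorem norm_gradient_eq (f : Vec n → ℝ) (x : Vec n) :
    ‖gradient f x‖ = ‖iteratedFDeriv ℝ 1 f x‖ := by
  rw [gradient, LinearIsometryEquiv.norm_map, norm_iteratedFDeriv_one]

/-! ### Tensor errors along a run and reduction to the scalar relations -/

namespace IsRun

variable {P : Params} {f : Vec n → ℝ} {x₀ : Vec n} {x s : ℕ → Vec n} {σ : ℕ → ℝ}
  {T : ℕ → Tensor n 3} {L : ℝ}

/-- The error of the approximate tensor is controlled by the lengths of the last `2m` steps. -/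
theorem norm_tensor_sub_le (h : IsRun P f x₀ x s σ T) (hf : ContDiff ℝ 3 f)
    (hL : LipschitzTensor 3 f L) (k : ℕ) :
    ‖T k - iteratedFDeriv ℝ 3 f (x k)‖ ≤ P.κC ^ P.m * (P.κA + 2 * L) *
      windowSum (2 * P.m) (stepLength s) ((k : ℤ) - 1) := by
  have hL0 : 0 ≤ L := by linarith [hL.1]
  have hA := P.κA_nonneg
  have hC := P.one_le_κC
  have hC0 : 0 ≤ P.κC := by linarith
  have hw := fun N j => windowSum_nonneg (N := N) (stepLength_nonneg s) j
  have hmpos : 0 < P.m := P.one_le_m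
  -- With `r = k % m` updates since the last restart, the exponent of `κC` and the window length
  -- both grow with `r`, which makes the induction close.
  suffices hr : ‖T k - iteratedFDeriv ℝ 3 f (x k)‖ ≤ P.κC ^ (k % P.m) * (P.κA + 2 * L) *
      windowSum (P.m + k % P.m) (stepLength s) ((k : ℤ) - 1) by
    have hlt := Nat.mod_lt k hmpos
    refine hr.trans (mul_le_mul ?_ (windowSum_mono (stepLength_nonneg s) (by omega) _) (hw _ _)
      (by positivity))
    exact mul_le_mul_of_nonneg_right (pow_le_pow_right₀ hC hlt.le) (by positivity)
  have hrestart : ∀ k : ℕ, k % P.m = 0 →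
      ‖T k - iteratedFDeriv ℝ 3 f (x k)‖ ≤ P.κC ^ (k % P.m) * (P.κA + 2 * L) *
        windowSum (P.m + k % P.m) (stepLength s) ((k : ℤ) - 1) := fun k hk => by
    have h1 := (h.tensor_restart k hk).trans (min_le_left _ _)
    rw [sum_Icc_stepLength] at h1
    rw [hk, pow_zero, one_mul, add_zero]
    exact h1.trans (mul_le_mul_of_nonneg_right (by linarith) (hw _ _))
  induction k with
  | zero => exact hrestart 0 (Nat.zero_mod _)
  | succ k ih =>
    by_cases hk : (k + 1) % P.m = 0
    · exact hrestart _ hk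
    · have hmod : (k + 1) % P.m = k % P.m + 1 := by
        have hlt := Nat.mod_lt k hmpos
        rcases Nat.lt_or_ge (k % P.m + 1) P.m with h1 | h1
        · rw [Nat.add_mod, Nat.mod_eq_of_lt (by omega : 1 < P.m), Nat.mod_eq_of_lt h1]
        · exfalso
          apply hk
          have h2 : k % P.m + 1 = P.m := by omega
          have h3 := Nat.div_add_mod k P.m
          rw [← h3, add_assoc, h2, Nat.mul_add_mod, Nat.mod_self]
      have hu := h.tensor_update k hk
      have hl := norm_averagedTensor_sub_left_le hf hL (x k) (s k)
      have hr := norm_averagedTensor_sub_right_le hf hL (x k) (s k)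
      rw [← h.x_succ] at hr
      set A := averagedTensor 3 f (x k) (s k)
      have t1 := norm_sub_le_norm_sub_add_norm_sub (T (k + 1)) A (iteratedFDeriv ℝ 3 f (x (k + 1)))
      have t2 := norm_sub_le_norm_sub_add_norm_sub (T k) (iteratedFDeriv ℝ 3 f (x k)) A
      rw [norm_sub_rev (iteratedFDeriv ℝ 3 f (x k)) A] at t2
      have hCk : (1 : ℝ) ≤ P.κC ^ (k % P.m) := one_le_pow₀ hC
      have hLs : 0 ≤ L * ‖s k‖ := by positivity
      -- The averaged tensor is within `L * ‖s k‖` of the exact one at both endpoints. The second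
      -- occurrence is multiplied by `κC ≥ 1` to factor `κC` out.
      have e1 : ‖T (k + 1) - iteratedFDeriv ℝ 3 f (x (k + 1))‖ ≤
          P.κC * (‖T k - iteratedFDeriv ℝ 3 f (x k)‖ + 2 * (L * ‖s k‖)) := by
        have := mul_le_mul_of_nonneg_left t2 hC0
        have := mul_le_mul_of_nonneg_left hl hC0
        have := mul_le_mul_of_nonneg_right hC hLs
        linarith
      refine e1.trans ?_
      have hcast : ((k + 1 : ℕ) : ℤ) - 1 = k := by push_cast; ring
      rw [hmod, hcast, ← add_assoc, windowSum_succ, stepLength_natCast, pow_succ', mul_assoc,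
        mul_assoc]
      refine mul_le_mul_of_nonneg_left ?_ hC0
      have e2 : 2 * (L * ‖s k‖) ≤ P.κC ^ (k % P.m) * ((P.κA + 2 * L) * ‖s k‖) := by
        have h1 : 2 * (L * ‖s k‖) ≤ (P.κA + 2 * L) * ‖s k‖ := by
          have := mul_nonneg hA (norm_nonneg (s k))
          linarith
        exact h1.trans (le_mul_of_one_le_left (by positivity) hCk)
      linear_combination ih + e2

/-- A run satisfies the scalar relations behind the complexity analysis. -/
theorem scalarRun {fLow κ Δ G B : ℝ} (h : IsRun P f x₀ x s σ T) (hf : ContDiff ℝ 3 f)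
    (hL : LipschitzTensor 3 f L) (hlow : BoundedBelowBy f fLow) (hκ : BoundedTensor 3 f κ)
    (hΔ : f x₀ - fLow ≤ Δ) (hG : ‖gradient f x₀‖ ≤ G) (hB : negCurvature f x₀ ≤ B) :
    ScalarRun (2 * P.m + 1) P.σ₀ P.θ₁ P.θ₂ (P.κC ^ P.m * (P.κA + 2 * L) + L) κ Δ G B
      (stepLength s) σ (fun k => f (x k)) (fun k => ‖gradient f (x k)‖)
      (fun k => negCurvature f (x k)) := by
  have hL0 : 0 ≤ L := by linarith [hL.1]
  have hA := P.κA_nonneg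
  have hC := P.one_le_κC
  have hf2 : ContDiff ℝ 2 f := hf.of_le (by norm_num)
  have hℓ0 := stepLength_nonneg s
  have hw := fun N j => windowSum_nonneg (N := N) hℓ0 j
  set D := P.κC ^ P.m * (P.κA + 2 * L) with hD
  have hD0 : 0 ≤ D := by positivity
  have hwk : ∀ k : ℕ, windowSum (2 * P.m + 1) (stepLength s) k =
      windowSum (2 * P.m) (stepLength s) ((k : ℤ) - 1) + ‖s k‖ := fun k => by
    rw [windowSum_succ, stepLength_natCast]
  have hsw : ∀ k : ℕ, ‖s k‖ ≤ windowSum (2 * P.m + 1) (stepLength s) k := fun k => by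
    rw [hwk]
    exact le_add_of_nonneg_left (hw _ _)
  have herr : ∀ k, ‖T k - iteratedFDeriv ℝ 3 f (x k)‖ + L * ‖s k‖ ≤
      (D + L) * windowSum (2 * P.m + 1) (stepLength s) k := fun k => by
    have h1 := h.norm_tensor_sub_le hf hL k
    rw [hwk]
    have h2 := mul_nonneg hL0 (hw (2 * P.m) ((k : ℤ) - 1))
    have h3 := mul_nonneg hD0 (norm_nonneg (s k))
    linear_combination h1 + h2 + h3
  have htaylor : ∀ i ≤ 3, ∀ k, ‖iteratedFDeriv ℝ i (taylorError f (x k) (T k)) (s k)‖ ≤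
      (D + L) * windowSum (2 * P.m + 1) (stepLength s) k ^ (3 - i + 1) := fun i hi k => by
    refine (norm_iteratedFDeriv_taylorError_le hf hL (x k) (T k) hi (s k)).trans ?_
    rw [pow_succ', ← mul_assoc]
    exact mul_le_mul (herr k) (pow_le_pow_left₀ (norm_nonneg _) (hsw k) _) (by positivity)
      (mul_nonneg (by positivity) (hw _ _))
  have hσpos : ∀ k, 0 ≤ σ k := fun k => by
    induction k with
    | zero => rw [h.σ_zero]; exact P.σ₀_pos.le
    | succ k ih => rw [h.σ_succ]; positivity
  have hdec : ∀ k, approxTaylor f (x k) (T k) (s k) + σ k / 24 * ‖s k‖ ^ 4 ≤ f (x k) := fun k => by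
    have h1 := h.step_decrease k
    simp only [model, approxTaylor_three_zero, norm_zero] at h1
    norm_num [Nat.factorial] at h1
    linarith
  refine ⟨hℓ0, fun j hj => stepLength_of_neg s hj, h.σ_zero, fun k => ?_, fun k => ?_, ?_, ?_,
    fun k => norm_nonneg _, fun k => negCurvature_nonneg _ _, fun k => ?_, fun k => ?_,
    fun k => ?_, fun k => ?_⟩
  · rw [stepLength_natCast]
    exact h.σ_succ k
  · simp only [h.x_zero]
    linarith [hlow (x k)]
  · simpa only [h.x_zero] using hG
  · simpa only [h.x_zero] using hB
  · have h1 := htaylor 0 (by norm_num) k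
    rw [norm_iteratedFDeriv_zero, Real.norm_eq_abs] at h1
    -- The new value is the Taylor model at `s k` plus the error, and `hdec` bounds the former.
    have h2 := (le_abs_self _).trans h1
    rw [taylorError, ← h.x_succ] at h2
    norm_num at h2
    rw [stepLength_natCast]
    linarith [hdec k]
  · have h1 := htaylor 1 (by norm_num) k
    rw [iteratedFDeriv_taylorError hf _ _ (by norm_num), ← h.x_succ] at h1
    have h2 := h.step_gradient k
    rw [norm_gradient_eq] at h2 ⊢
    have h3 := norm_le_norm_add_norm_sub' (iteratedFDeriv ℝ 1 f (x (k + 1)))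
      (iteratedFDeriv ℝ 1 (approxTaylor f (x k) (T k)) (s k))
    have h4 := mul_le_mul_of_nonneg_left (pow_le_pow_left₀ (norm_nonneg _) (hsw k) 3)
      (mul_nonneg (by linarith [P.one_lt_θ₁] : 0 ≤ P.θ₁) (hσpos k))
    -- Nonnegativity allows the factor `1 / 3!` to be dropped.
    have h5 : 0 ≤ P.θ₁ * σ k * ‖s k‖ ^ 3 := mul_nonneg
      (mul_nonneg (by linarith [P.one_lt_θ₁] : 0 ≤ P.θ₁) (hσpos k)) (by positivity)
    norm_num [Nat.factorial, -norm_iteratedFDeriv_one] at h1 h2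
    linarith
  · have h1 := htaylor 2 (by norm_num) k
    rw [iteratedFDeriv_taylorError hf _ _ (by norm_num), ← h.x_succ] at h1
    have h2 := h.step_curvature k
    have h3 := negCurvature_le_add_norm hf2
      (contDiff_approxTaylor_three f (x k) (T k)) (x (k + 1)) (s k)
    have h4 := mul_le_mul_of_nonneg_left (pow_le_pow_left₀ (norm_nonneg _) (hsw k) 2)
      (mul_nonneg (by linarith [P.one_lt_θ₂] : 0 ≤ P.θ₂) (hσpos k))
    have h5 : 0 ≤ P.θ₂ * σ k * ‖s k‖ ^ 2 := mul_nonneg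
      (mul_nonneg (by linarith [P.one_lt_θ₂] : 0 ≤ P.θ₂) (hσpos k)) (by positivity)
    norm_num [Nat.factorial] at h1 h2
    linarith
  · rw [stepLength_natCast]
    have h1 := hdec k
    simp only [approxTaylor_three, Pi.add_apply, Pi.smul_apply, smul_eq_mul] at h1
    -- Each Taylor term is bounded below: the linear one by the gradient norm, the quadratic one by
    -- the negative curvature alone, the cubic one by `‖T k‖`.
    have g1 := (iteratedFDeriv ℝ 1 f (x k)).le_opNorm (fun _ => s k)
    have g2 := neg_iteratedFDeriv_two_le hf2 (x k) (s k)
    have g3 := (T k).le_opNorm (fun _ => s k)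
    rw [← norm_gradient_eq] at g1
    simp only [Finset.prod_const, Finset.card_univ, Fintype.card_fin, Real.norm_eq_abs,
      pow_one] at g1 g3
    have g1' := neg_le_of_abs_le g1
    have g3' := neg_le_of_abs_le g3
    have hT : ‖T k‖ ≤ κ + (D + L) * windowSum (2 * P.m + 1) (stepLength s) ((k : ℤ) - 1) := by
      have e1 := norm_le_norm_add_norm_sub' (T k) (iteratedFDeriv ℝ 3 f (x k))
      have e2 := h.norm_tensor_sub_le hf hL k
      have e3 := mul_le_mul_of_nonneg_left
        (windowSum_mono hℓ0 (Nat.le_succ (2 * P.m)) ((k : ℤ) - 1)) hD0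
      have e4 := mul_nonneg hL0 (hw (2 * P.m + 1) ((k : ℤ) - 1))
      have e5 := hκ le_rfl (x k)
      linear_combination e1 + e2 + e3 + e4 + e5
    have hT' := mul_le_mul_of_nonneg_right hT (by positivity : 0 ≤ ‖s k‖ ^ 3)
    have hT0 : 0 ≤ ‖T k‖ * ‖s k‖ ^ 3 := by positivity
    have hc0 : 0 ≤ negCurvature f (x k) * ‖s k‖ ^ 2 :=
      mul_nonneg (negCurvature_nonneg _ _) (by positivity)
    linarith

end IsRun

theorem minUpTo_le {a : ℕ → ℝ} {j k : ℕ} (hj : j ≤ k) : minUpTo a k ≤ a (j + 1) :=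
  Finset.inf'_le a (Finset.mem_Icc.2 ⟨Nat.le_add_left 1 j, Nat.succ_le_succ hj⟩)

end ARpApprox

theorem mainTheorem7 (P : ARpApprox.Params) (L κ₃ Δ G B : ℝ) :
    ∃ C₁ C₂ : ℝ,
      ∀ (n : ℕ) (f : ARpApprox.Vec n → ℝ) (fLow : ℝ) (x₀ : ARpApprox.Vec n),
        ARpApprox.SmoothObjective 3 f →
        ARpApprox.BoundedBelowBy f fLow →
        ARpApprox.LipschitzTensor 3 f L →
        ARpApprox.IntermediateBoundedBelow 3 f →
        ARpApprox.BoundedTensor 3 f κ₃ →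
        f x₀ - fLow ≤ Δ →
        ‖gradient f x₀‖ ≤ G →
        ARpApprox.negCurvature f x₀ ≤ B →
        ∀ (x s : ℕ → ARpApprox.Vec n) (σ : ℕ → ℝ) (T : ℕ → ARpApprox.Tensor n 3),
          ARpApprox.IsRun P f x₀ x s σ T →
          ∀ k : ℕ,
            ARpApprox.minUpTo (fun j => ‖gradient f (x j)‖) k ≤
              C₁ / ((k : ℝ) + 1) ^ (3 / 4 : ℝ) ∧
            ARpApprox.minUpTo (fun j => ARpApprox.negCurvature f (x j)) k ≤
              C₂ / ((k : ℝ) + 1) ^ (1 / 2 : ℝ) := by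
  -- The constants precede `f`, so the signs of `L` and `κ₃` are not yet known. A negative value
  -- contradicts the hypotheses on any `f`, and then any constants do.
  by_cases hL : 0 ≤ L
  swap
  · exact ⟨0, 0, fun _ _ _ _ _ _ hLip => absurd (by linarith [hLip.1]) hL⟩
  by_cases hκ : 0 ≤ κ₃
  swap
  · exact ⟨0, 0, fun _ _ _ x₀ _ _ _ _ hb =>
      absurd ((norm_nonneg _).trans (hb le_rfl x₀)) hκ⟩
  have hA := P.κA_nonneg
  have hC := P.one_le_κC
  obtain ⟨C₁, C₂, hrate⟩ := ARpApprox.ScalarRun.exists_rate (2 * P.m + 1) Δ G B P.σ₀_pos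
    (by linarith [P.one_lt_θ₁] : 0 ≤ P.θ₁) (by linarith [P.one_lt_θ₂] : 0 ≤ P.θ₂)
    (by positivity : 0 ≤ P.κC ^ P.m * (P.κA + 2 * L) + L) hκ
  refine ⟨C₁, C₂, fun n f fLow x₀ hf hlow hLip _ hb hΔ hG hB x s σ T hrun k => ?_⟩
  obtain ⟨j, hj, h1, h2⟩ := hrate (hrun.scalarRun hf.2 hLip hlow hb hΔ hG hB) k
  exact ⟨(ARpApprox.minUpTo_le hj).trans h1, (ARpApprox.minUpTo_le hj).trans h2⟩
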